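/- **Problem.** Let $1\le m\le T$ be integers, $\mathcal T=\{1,\dots,T\}$. Let $Z^1,\dots,Z^T$ be sets of local decisions $(r,\mathbf x,\mathbf y)$, $Z^s\subseteq\mathbb R\times\mathbb R^{n_s}\times\mathbb R^m$, let $Q\subseteq\mathbb R^m$, let $C\subseteq\mathbb R^m$ be a nonempty closed convex cone, and put $\Psi=Q+C$. Assume: * **A1.** $Q$ is compact and convex, every $Z^s$ is compact, and there are $(r^s,\mathbf x^s,\mathbf y^s)\in Z^s$ $(s\in\mathcal T)$ with $\sum_{s}\mathbf y^s\in T\Psi$. * **A2.** With constants $d_y,d_r\ge0$ and $\underline d>0$, for every $s\in\mathcal T$: (a) $\|\mathbf y-\mathbf v\|_\infty\le d_y$ for all $(r,\mathbf x,\mathbf y)\in Z^s$ and $\mathbf v\in Q$; (b) there is $(\tilde r,\tilde{\mathbf x},\tilde{\mathbf y})\in\operatorname{conv}(Z^s)$ such that $\tilde r\ge r-d_r$ for all $(r,\mathbf x,\mathbf y)\in Z^s$ and the closed Euclidean ball of radius $\underline d$ around $\tilde{\mathbf y}$ is contained in $\Psi$. Let $z^R=\max\{\sum_{s}r^s:\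 (r^s,\mathbf x^s,\mathbf y^s)\in\operatorname{conv}(Z^s)\ (s\in\mathcal T),\ \sum_{s}\mathbf y^s\in T\Psi\}$. **Input.** Let $\mathcal T$ be partitioned into nonempty groups $\mathcal T^1,\dots,\mathcal T^K$, and let $\pi$ be uniformly distributed on the permutations of $\mathcal T$ that map every group to itself (each group is uniformly permuted, independently of the others). The set revealed at time $t$ is $\Omega^t=Z^{\pi(t)}$. **Algorithm.** Let $\eta^t=\min\{\frac1m,\frac1{\sqrt{mt}}\}$ and $C^\circ=\{\mathbf u:\mathbf u^\top\mathbf v\le0\ \text{for all } \mathbf v\in C\}$. Start with $\mathbf p^1=\mathbf 0$. For $t=1,\dots,T$ choose $(\hat r^t,\hat{\mathbf x}^t,\hat{\mathbf y}^t)\in\arg\max\{r-(\mathbf p^t)^\top\mathbf y:(r,\mathbf x,\mathbf y)\in\Omega^t\}$ and $\hat{\mathbf v}^t\in\arg\max_{\mathbf v\in Q}(\mathbf p^t)^\top\mathbf v$, and let $\mathbf p^{t+1}$ be the Euclidean projection of $\mathbf p^t-\eta^t(\hat{\mathbf v}^t-\hat{\mathbf y}^t)$ onto $C^\circ$. Among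 several maximizers the choice at time $t$ is arbitrary, but is determined by $\pi(1),\dots,\pi(t)$. Let $\mathrm{Reward}=\sum_{t=1}^T\hat r^t$. **Unevenness.** For $i,j\in\mathcal T$ let $d_{ij}=\sum_{t=\min\{i,j\}}^{\max\{i,j\}-1}\eta^t$. Let $w^k$ be the 1-Wasserstein distance, with ground distance $d$, between the uniform distributions on $\mathcal T^k$ and on $\mathcal T$, that is, the minimum of $\sum_{i\in\mathcal T^k}\sum_{j\in\mathcal T}d_{ij}q_{ij}$ over all $q\ge0$ with $\sum_{i\in\mathcal T^k}q_{ij}=\frac1T$ for all $j\in\mathcal T$ and $\sum_{j\in\mathcal T}q_{ij}=\frac1{|\mathcal T^k|}$ for all $i\in\mathcal T^k$. Let $W=\sum_{k=1}^K m\,|\mathcal T^k|\,w^k$. **Theorem.** For all $d_y,d_r\ge0$ and $\underline d>0$ there is a constant $c>0$, depending only on $d_y,d_r,\underline d$, such that in every situation as above $$\mathbb E_\pi[\mathrm{Reward}]\ \ge\ z^R-c\Big(W+\sqrt{m\log(\max\{m,2\})}\,\sum_{k=1}^K\sqrt{|\mathcal T^k|}\Big).$$ -/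

import Mathlib

noncomputable section

open scoped Pointwise

/-- A local decision `(r, x, y)`: reward `r`, auxiliary variables `x ∈ ℝⁿ`, impact `y ∈ ℝᵐ`. -/
abbrev Decision (m n : ℕ) : Type :=
  ℝ × EuclideanSpace ℝ (Fin n) × EuclideanSpace ℝ (Fin m)

/-- The data of an online decision making problem with `T` time steps and an `m`-dimensional
goal: the feasible sets `Z¹, …, Zᵀ` (the dimension of the auxiliary variables may vary), and the
sets `Q` and `C` whose Minkowski sum is the goal set. A `ProperCone` is a nonempty closed convex
cone. The element `t : Fin T` stands for the time step `t + 1 ∈ {1, …, T}`. -/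
structure ODMP (m T : ℕ) where
  /-- dimension of the auxiliary variables of each feasible set -/
  dim : Fin T → ℕ
  /-- the feasible sets -/
  Z : (s : Fin T) → Set (Decision m (dim s))
  /-- the bounded part of the goal set -/
  Q : Set (EuclideanSpace ℝ (Fin m))
  /-- the recession cone of the goal set -/
  C : ProperCone ℝ (EuclideanSpace ℝ (Fin m))

namespace ODMP

variable {m T : ℕ}

/-- The goal set `Ψ = Q + C`. -/
def goalSet (I : ODMP m T) : Set (EuclideanSpace ℝ (Fin m)) :=
  I.Q + (I.C : Set (EuclideanSpace ℝ (Fin m)))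

/-- Assumption A1: the offline problem is feasible, the local feasible sets are compact, and the
goal set is the sum of a compact convex set and a closed convex cone. -/
structure AssumptionA1 (I : ODMP m T) : Prop where
  feasible : ∃ ω : (s : Fin T) → Decision m (I.dim s),
    (∀ s, ω s ∈ I.Z s) ∧ ∑ s, (ω s).2.2 ∈ (T : ℝ) • I.goalSet
  compact_Z : ∀ s, IsCompact (I.Z s)
  compact_Q : IsCompact I.Q
  convex_Q : Convex ℝ I.Q

/-- Assumption A2 with constants `dy`, `dr`, `du`. -/
structure AssumptionA2 (I : ODMP m T) (dy dr du : ℝ) : Prop where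
  impact_bound : ∀ s, ∀ ω ∈ I.Z s, ∀ v ∈ I.Q, ∀ i, |ω.2.2 i - v i| ≤ dy
  strongly_feasible : ∀ s, ∃ ω ∈ convexHull ℝ (I.Z s),
    (∀ ω' ∈ I.Z s, ω'.1 - dr ≤ ω.1) ∧ Metric.closedBall ω.2.2 du ⊆ I.goalSet

/-- The value `z^R` of the partial convexification: maximize the total reward over decisions in the
convex hulls of the feasible sets, subject to the goal constraint. (Under A1 the set below is
nonempty and compact, so the supremum is a maximum.) -/
def zR (I : ODMP m T) : ℝ :=
  sSup {z : ℝ | ∃ ω : (s : Fin T) → Decision m (I.dim s),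
    (∀ s, ω s ∈ convexHull ℝ (I.Z s)) ∧ ∑ s, (ω s).2.2 ∈ (T : ℝ) • I.goalSet ∧
    z = ∑ s, (ω s).1}

/-- The polar cone `{u | ⟪u, v⟫ ≤ 0 for all v ∈ C}`. -/
def polarCone (C : ProperCone ℝ (EuclideanSpace ℝ (Fin m))) :
    Set (EuclideanSpace ℝ (Fin m)) :=
  {u | ∀ v ∈ C, inner ℝ u v ≤ 0}

/-- `y` is a point of `S` that is nearest to `x` in Euclidean norm, i.e. the projection of `x` onto
`S` when `S` is nonempty, closed and convex. -/
def IsProj (S : Set (EuclideanSpace ℝ (Fin m))) (x y : EuclideanSpace ℝ (Fin m)) : Prop :=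
  y ∈ S ∧ ∀ z ∈ S, ‖x - y‖ ≤ ‖x - z‖

/-- The stepsize `η^t = min {1/m, 1/√(mt)}` of time step `t ∈ {1, 2, …}`. -/
def stepSize (m t : ℕ) : ℝ :=
  min (1 / (m : ℝ)) (1 / Real.sqrt ((m : ℝ) * (t : ℝ)))

/-- `(ω, v, p)` is a run of the Fenchel dual-based algorithm with stepsizes `stepSize m` on the
input `Ω^t = Z^{π(t)}`: `ω t` and `v t` are the solutions of the two subproblems at step `t`, and
`p t.castSucc`, `p t.succ` are the multipliers before and after step `t`. -/
structure IsRun (I : ODMP m T) (π : Equiv.Perm (Fin T))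
    (ω : (t : Fin T) → Decision m (I.dim (π t))) (v : Fin T → EuclideanSpace ℝ (Fin m))
    (p : Fin (T + 1) → EuclideanSpace ℝ (Fin m)) : Prop where
  init : p 0 = 0
  local_mem : ∀ t, ω t ∈ I.Z (π t)
  local_opt : ∀ t, ∀ ω' ∈ I.Z (π t),
    ω'.1 - inner ℝ (p t.castSucc) ω'.2.2 ≤ (ω t).1 - inner ℝ (p t.castSucc) (ω t).2.2
  support_mem : ∀ t, v t ∈ I.Q
  support_opt : ∀ t, ∀ v' ∈ I.Q, inner ℝ (p t.castSucc) v' ≤ inner ℝ (p t.castSucc) (v t)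
  update : ∀ t : Fin T, IsProj (polarCone I.C)
    (p t.castSucc - stepSize m (t.val + 1) • (v t - (ω t).2.2)) (p t.succ)

/-- The permutations of the time steps that map every group of the partition to itself. -/
def groupedPerms (P : Finpartition (Finset.univ : Finset (Fin T))) :
    Finset (Equiv.Perm (Fin T)) :=
  Finset.univ.filter fun π => ∀ B ∈ P.parts, ∀ t ∈ B, π t ∈ B

/-- A run of the algorithm for every grouped permutation, where the solutions that the oracles
return at step `t` (among possibly many optimal ones) depend only on what has been revealed
up to step `t`. -/
structure IsOnlineExecution (I : ODMP m T) (P : Finpartition (Finset.univ : Finset (Fin T)))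
    (ω : (π : Equiv.Perm (Fin T)) → (t : Fin T) → Decision m (I.dim (π t)))
    (v : Equiv.Perm (Fin T) → Fin T → EuclideanSpace ℝ (Fin m))
    (p : Equiv.Perm (Fin T) → Fin (T + 1) → EuclideanSpace ℝ (Fin m)) : Prop where
  run : ∀ π ∈ groupedPerms P, I.IsRun π (ω π) (v π) (p π)
  nonanticipating : ∀ π ∈ groupedPerms P, ∀ π' ∈ groupedPerms P, ∀ t : Fin T,
    (∀ s ≤ t, π s = π' s) →
      (⟨π t, ω π t⟩ : (s : Fin T) × Decision m (I.dim s)) = ⟨π' t, ω π' t⟩ ∧ v π t = v π' t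

/-- The reward `∑_t r̂^t` collected by the decisions `ω`. -/
def reward (I : ODMP m T) (π : Equiv.Perm (Fin T))
    (ω : (t : Fin T) → Decision m (I.dim (π t))) : ℝ :=
  ∑ t, (ω t).1

/-- Expectation of `f π` for `π` uniformly distributed on the grouped permutations, i.e. the
groups are permuted uniformly and independently of each other. -/
def groupedExpectation (P : Finpartition (Finset.univ : Finset (Fin T)))
    (f : Equiv.Perm (Fin T) → ℝ) : ℝ :=
  (∑ π ∈ groupedPerms P, f π) / ((groupedPerms P).card : ℝ)

/-- The distance `d_{ij}` of two time steps: the sum of the stepsizes between them. -/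
def stepDist (m : ℕ) (i j : Fin T) : ℝ :=
  if i < j then ∑ t ∈ Finset.Ico (i.val + 1) (j.val + 1), stepSize m t
  else ∑ t ∈ Finset.Ico (j.val + 1) (i.val + 1), stepSize m t

/-- The 1-Wasserstein distance, for the ground distance `stepDist m`, between the uniform
distributions on the group `B` and on all time steps: the optimal value of the transportation
linear program (a minimum whenever `B` is nonempty). -/
def wasserstein (m : ℕ) (B : Finset (Fin T)) : ℝ :=
  sInf {c : ℝ | ∃ q : B → Fin T → ℝ, (∀ i j, 0 ≤ q i j) ∧
    (∀ j, ∑ i : B, q i j = 1 / (T : ℝ)) ∧ (∀ i, ∑ j, q i j = 1 / (B.card : ℝ)) ∧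
    c = ∑ i : B, ∑ j : Fin T, stepDist m i.val j * q i j}

/-- The unevenness `W = ∑_k m |𝒯^k| w^k` of the partition. -/
def unevenness (m : ℕ) (P : Finpartition (Finset.univ : Finset (Fin T))) : ℝ :=
  ∑ B ∈ P.parts, (m : ℝ) * (B.card : ℝ) * wasserstein m B

end ODMP

end

namespace ODMP

open scoped Pointwise

variable {m T : ℕ}

/-! The algorithm is projected subgradient descent on a Fenchel dual. Fix decisions `z` feasible for
the convexified problem, with impacts `y s` and mean impact `w` in the goal set. Optimality of both
subproblems at each step bounds the reward below by the reward of `z`, plus `∑ ⟪p^t, w - y (π t)⟫`,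
minus a regret term (`IsRun.reward_ge`). Strong feasibility bounds the multipliers by a radius `R`
independent of `m` and `T` (`IsRun.norm_le`), so the regret is `O(√(mT))`.

For `t` in a group `B` with mean impact `ȳ_B`, write `w - y (π t) = (w - ȳ_B) - (y (π t) - ȳ_B)`.
The first part is controlled for every single `π`: the multipliers are Lipschitz for the stepsize
distance, so their mean over `B` differs from their overall mean by at most a multiple of the
Wasserstein distance; this gives `W` (`sum_inner_sub_average_ge`). The second part needs the
expectation: `p^t` depends on the past only, so exchangeability replaces `y (π t)` by the mean over
the unrevealed rest of `B`, and sampling without replacement concentrates that mean around `ȳ_B` at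
rate `1/√(remaining)`. Summing gives `O(√m ∑ √|B|)` (`sum_inner_centered_le`), without a logarithm.
-/

theorem convex_polarCone (C : ProperCone ℝ (EuclideanSpace ℝ (Fin m))) :
    Convex ℝ (polarCone C) := by
  intro x hx y hy a b ha hb _ v hv
  rw [inner_add_left, real_inner_smul_left, real_inner_smul_left]
  have h1 := mul_nonpos_of_nonneg_of_nonpos ha (hx v hv)
  have h2 := mul_nonpos_of_nonneg_of_nonpos hb (hy v hv)
  linarith

theorem zero_mem_polarCone (C : ProperCone ℝ (EuclideanSpace ℝ (Fin m))) :
    0 ∈ polarCone C := fun v _ => by simp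

theorem IsProj.inner_le_zero {S : Set (EuclideanSpace ℝ (Fin m))} (hS : Convex ℝ S)
    {x y z : EuclideanSpace ℝ (Fin m)} (h : IsProj S x y) (hz : z ∈ S) :
    inner ℝ (x - y) (z - y) ≤ 0 := by
  refine (norm_eq_iInf_iff_real_inner_le_zero hS h.1).1 ?_ z hz
  have : Nonempty S := ⟨⟨y, h.1⟩⟩
  refine le_antisymm (le_ciInf fun w => h.2 w w.2) ?_
  exact ciInf_le (f := fun w : S => ‖x - w‖)
    ⟨0, by rintro _ ⟨w, rfl⟩; exact norm_nonneg _⟩ ⟨y, h.1⟩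

theorem IsProj.norm_sub_sq_le {S : Set (EuclideanSpace ℝ (Fin m))} (hS : Convex ℝ S)
    {x y z : EuclideanSpace ℝ (Fin m)} (h : IsProj S x y) (hz : z ∈ S) :
    ‖y - z‖ ^ 2 ≤ ‖x - z‖ ^ 2 := by
  have h1 := h.inner_le_zero hS hz
  have h2 : ‖x - z‖ ^ 2 = ‖x - y‖ ^ 2 - 2 * inner ℝ (x - y) (z - y) + ‖z - y‖ ^ 2 := by
    rw [← norm_sub_sq_real]; congr 2; abel
  rw [h2, norm_sub_rev y z]
  nlinarith [sq_nonneg ‖x - y‖]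

theorem IsProj.norm_sub_le {S : Set (EuclideanSpace ℝ (Fin m))} (hS : Convex ℝ S)
    {x y z : EuclideanSpace ℝ (Fin m)} (h : IsProj S x y) (hz : z ∈ S) :
    ‖y - z‖ ≤ ‖x - z‖ :=
  le_of_sq_le_sq (h.norm_sub_sq_le hS hz) (norm_nonneg _)

theorem IsProj.unique {S : Set (EuclideanSpace ℝ (Fin m))} (hS : Convex ℝ S)
    {x y z : EuclideanSpace ℝ (Fin m)} (hy : IsProj S x y) (hz : IsProj S x z) : y = z := by
  have h1 := hy.inner_le_zero hS hz.1
  have h2 := hz.inner_le_zero hS hy.1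
  have h3 : inner ℝ (z - y) (z - y) = inner ℝ (x - y) (z - y) + inner ℝ (x - z) (y - z) := by
    rw [← neg_sub z y, inner_neg_right, ← sub_eq_add_neg, ← inner_sub_left]
    congr 1; abel
  rw [real_inner_self_eq_norm_sq] at h3
  have h4 : ‖z - y‖ ^ 2 = 0 := le_antisymm (by linarith) (sq_nonneg _)
  exact (sub_eq_zero.1 (norm_eq_zero.1 (pow_eq_zero_iff two_ne_zero |>.1 h4))).symm

theorem norm_sub_le_of_coord {a b : EuclideanSpace ℝ (Fin m)} {d : ℝ} (hd : 0 ≤ d)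
    (h : ∀ i, |a i - b i| ≤ d) : ‖a - b‖ ≤ Real.sqrt m * d := by
  rw [EuclideanSpace.norm_eq]
  refine Real.sqrt_le_iff.2 ⟨by positivity, ?_⟩
  rw [mul_pow, Real.sq_sqrt (Nat.cast_nonneg _)]
  calc ∑ i, ‖(a - b) i‖ ^ 2 ≤ ∑ _i : Fin m, d ^ 2 :=
        Finset.sum_le_sum fun i _ => by
          simpa using pow_le_pow_left₀ (abs_nonneg _) (h i) 2
    _ = _ := by simp

/-! ### Stepsize estimates -/

section StepSize

theorem stepSize_pos (hm : 1 ≤ m) {t : ℕ} (ht : 1 ≤ t) : 0 < stepSize m t := by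
  have : (0 : ℝ) < m := by exact_mod_cast hm
  have : (0 : ℝ) < t := by exact_mod_cast ht
  unfold stepSize; positivity

theorem stepSize_antitone (hm : 1 ≤ m) {s t : ℕ} (hs : 1 ≤ s) (h : s ≤ t) :
    stepSize m t ≤ stepSize m s := by
  have h0 : (0 : ℝ) < m := by exact_mod_cast hm
  have h1 : (0 : ℝ) < s := by exact_mod_cast hs
  have h2 : (s : ℝ) ≤ t := by exact_mod_cast h
  unfold stepSize
  gcongr

theorem stepSize_mul_le_one (hm : 1 ≤ m) (t : ℕ) : stepSize m t * m ≤ 1 := by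
  have h0 : (0 : ℝ) < m := by exact_mod_cast hm
  exact (le_div_iff₀ h0).1 (min_le_left _ _)

theorem sqrt_le_self_natCast (hm : 1 ≤ m) : Real.sqrt m ≤ m := by
  have h0 : (1 : ℝ) ≤ m := by exact_mod_cast hm
  exact Real.sqrt_le_iff.2 ⟨by positivity, by nlinarith⟩

/-- The reciprocal is `max {m, √(m(T+1))}`, and `m ≤ T` absorbs the first entry. -/
theorem one_div_stepSize_succ_le (hm : 1 ≤ m) (hT : m ≤ T) :
    1 / stepSize m (T + 1) ≤ 2 * Real.sqrt (m * T) := by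
  have h0 : (1 : ℝ) ≤ m := by exact_mod_cast hm
  have h1 : (m : ℝ) ≤ T := by exact_mod_cast hT
  have hpos : 0 < Real.sqrt (m * T) := Real.sqrt_pos.2 (by nlinarith)
  rw [one_div, inv_le_comm₀ (stepSize_pos hm (by omega)) (by positivity)]
  unfold stepSize
  rw [← one_div]
  refine le_min ?_ ?_
  · refine one_div_le_one_div_of_le (by linarith) ?_
    have : (m : ℝ) ≤ Real.sqrt (m * T) := Real.le_sqrt_of_sq_le (by nlinarith)
    linarith
  · push_cast
    refine one_div_le_one_div_of_le (Real.sqrt_pos.2 (by nlinarith)) ?_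
    refine Real.sqrt_le_iff.2 ⟨by positivity, ?_⟩
    rw [mul_pow, Real.sq_sqrt (by nlinarith)]
    nlinarith

theorem inv_sqrt_succ_le (n : ℕ) :
    2 * Real.sqrt n + 1 / Real.sqrt (n + 1) ≤ 2 * Real.sqrt (n + 1) := by
  have h1 : 0 < Real.sqrt ((n : ℝ) + 1) := Real.sqrt_pos.2 (by positivity)
  have h2 := Real.sq_sqrt (show (0 : ℝ) ≤ n + 1 by positivity)
  have h3 := Real.sq_sqrt (show (0 : ℝ) ≤ n by positivity)
  rw [← sub_nonneg]
  have : 2 * Real.sqrt (n + 1) - (2 * Real.sqrt n + 1 / Real.sqrt (n + 1))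
      = (Real.sqrt (n + 1) - Real.sqrt n) ^ 2 / Real.sqrt (n + 1) := by
    field_simp
    nlinarith
  rw [this]
  positivity

theorem sum_stepSize_le (hm : 1 ≤ m) (n : ℕ) :
    ∑ t ∈ Finset.range n, stepSize m (t + 1) * m ≤ 2 * Real.sqrt (m * n) := by
  have h0 : (0 : ℝ) < m := by exact_mod_cast hm
  have hs : 0 < Real.sqrt (m : ℝ) := Real.sqrt_pos.2 h0
  induction n with
  | zero => simp
  | succ n ih =>
    rw [Finset.sum_range_succ]
    have h1 : stepSize m (n + 1) * m ≤ Real.sqrt m * (1 / Real.sqrt (n + 1)) := by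
      calc stepSize m (n + 1) * m ≤ 1 / Real.sqrt (m * ((n + 1 : ℕ) : ℝ)) * m := by
            gcongr; exact min_le_right _ _
        _ = _ := by
            rw [Real.sqrt_mul h0.le]
            push_cast
            have := Real.mul_self_sqrt h0.le
            field_simp
            nlinarith
    have h2 := mul_le_mul_of_nonneg_left (inv_sqrt_succ_le n) hs.le
    rw [Real.sqrt_mul h0.le] at ih ⊢
    push_cast
    linarith

end StepSize

/-! ### Elementary summation inequalities -/

/-- The cardinalities run through `|B|, …, 1`. Inserting a new minimum leaves the counts of all
other elements unchanged. -/
theorem sum_inv_sqrt_card_le {α : Type*} [LinearOrder α] (B : Finset α) :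
    ∑ t ∈ B, 1 / Real.sqrt ((B.filter (t ≤ ·)).card : ℝ) ≤ 2 * Real.sqrt (B.card : ℝ) := by
  induction B using Finset.induction_on_min with
  | empty => simp
  | insert a s ha ih =>
    have has : a ∉ s := fun h => lt_irrefl _ (ha a h)
    rw [Finset.sum_insert has, Finset.card_insert_of_notMem has]
    have h1 : (insert a s).filter (a ≤ ·) = insert a s := by
      refine Finset.filter_true_of_mem fun x hx => ?_
      rcases Finset.mem_insert.1 hx with rfl | hx
      · exact le_rfl
      · exact (ha x hx).le
    have h2 : ∀ t ∈ s, (insert a s).filter (t ≤ ·) = s.filter (t ≤ ·) := fun t ht => by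
      rw [Finset.filter_insert, if_neg (not_le.2 (ha t ht))]
    rw [h1, Finset.card_insert_of_notMem has,
      Finset.sum_congr rfl fun t ht => by rw [h2 t ht]]
    have := inv_sqrt_succ_le s.card
    push_cast
    linarith

/-- Abel summation with increasing weights: since `P - R ≤ 0`, raising the weight only lowers the
left side. -/
theorem sum_mul_sub_ge {a P : ℕ → ℝ} {R : ℝ} (n : ℕ) (ha0 : 0 ≤ a 0)
    (ha : ∀ i < n, a i ≤ a (i + 1)) (hP : ∀ i ≤ n, P i ≤ R) :
    a n * (P n - R) ≤ ∑ i ∈ Finset.range n, a i * (P (i + 1) - P i) := by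
  induction n with
  | zero => simpa using mul_nonpos_of_nonneg_of_nonpos ha0 (sub_nonpos.2 (hP 0 le_rfl))
  | succ n ih =>
    rw [Finset.sum_range_succ]
    have h1 := ih (fun i hi => ha i (by omega)) (fun i hi => hP i (by omega))
    have h2 := mul_nonneg (sub_nonneg.2 (ha n (by omega))) (sub_nonneg.2 (hP (n + 1) le_rfl))
    nlinarith

theorem sqrt_sum_le_sum_sqrt {α : Type*} (s : Finset α) (f : α → ℝ) (hf : ∀ i ∈ s, 0 ≤ f i) :
    Real.sqrt (∑ i ∈ s, f i) ≤ ∑ i ∈ s, Real.sqrt (f i) := by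
  refine Real.sqrt_le_iff.2 ⟨Finset.sum_nonneg fun _ _ => Real.sqrt_nonneg _, ?_⟩
  calc ∑ i ∈ s, f i = ∑ i ∈ s, Real.sqrt (f i) ^ 2 :=
        Finset.sum_congr rfl fun i hi => (Real.sq_sqrt (hf i hi)).symm
    _ ≤ _ := Finset.sum_sq_le_sq_sum_of_nonneg fun _ _ => Real.sqrt_nonneg _

/-! ### Sampling without replacement inside the groups -/

section GroupedPerms

variable {P : Finpartition (Finset.univ : Finset (Fin T))} {B : Finset (Fin T)}

theorem mem_groupedPerms {π : Equiv.Perm (Fin T)} :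
    π ∈ groupedPerms P ↔ ∀ B ∈ P.parts, ∀ t ∈ B, π t ∈ B := by
  simp [groupedPerms]

theorem one_mem_groupedPerms : (1 : Equiv.Perm (Fin T)) ∈ groupedPerms P :=
  mem_groupedPerms.2 fun _ _ _ ht => ht

theorem card_groupedPerms_pos : (0 : ℝ) < ((groupedPerms P).card : ℝ) :=
  Nat.cast_pos.2 (Finset.card_pos.2 ⟨1, one_mem_groupedPerms⟩)

theorem mul_swap_mem_groupedPerms (hB : B ∈ P.parts) {a b : Fin T} (ha : a ∈ B) (hb : b ∈ B)
    {π : Equiv.Perm (Fin T)} (hπ : π ∈ groupedPerms P) :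
    π * Equiv.swap a b ∈ groupedPerms P := by
  rw [mem_groupedPerms] at hπ ⊢
  intro B' hB' t ht
  rw [Equiv.Perm.mul_apply]
  refine hπ B' hB' _ ?_
  rcases eq_or_ne t a with rfl | hta
  · rw [Equiv.swap_apply_left]
    exact P.eq_of_mem_parts hB hB' ha ht ▸ hb
  rcases eq_or_ne t b with rfl | htb
  · rw [Equiv.swap_apply_right]
    exact P.eq_of_mem_parts hB hB' hb ht ▸ ha
  · rwa [Equiv.swap_apply_of_ne_of_ne hta htb]

/-- Exchangeability of two positions in one group. -/
theorem sum_groupedPerms_mul_swap (hB : B ∈ P.parts) {a b : Fin T} (ha : a ∈ B) (hb : b ∈ B)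
    (f : Equiv.Perm (Fin T) → ℝ) :
    ∑ π ∈ groupedPerms P, f (π * Equiv.swap a b) = ∑ π ∈ groupedPerms P, f π := by
  refine Finset.sum_nbij' (· * Equiv.swap a b) (· * Equiv.swap a b)
    (fun π hπ => mul_swap_mem_groupedPerms hB ha hb hπ)
    (fun π hπ => mul_swap_mem_groupedPerms hB ha hb hπ) ?_ ?_ ?_ <;>
  simp [mul_assoc]

theorem sum_comp_groupedPerm {M : Type*} [AddCommMonoid M] (hB : B ∈ P.parts)
    {π : Equiv.Perm (Fin T)} (hπ : π ∈ groupedPerms P) (f : Fin T → M) :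
    ∑ u ∈ B, f (π u) = ∑ u ∈ B, f u := by
  have h : B.map π.toEmbedding = B := by
    refine Finset.eq_of_subset_of_card_le (fun x hx => ?_) (by simp)
    obtain ⟨u, hu, rfl⟩ := Finset.mem_map.1 hx
    exact mem_groupedPerms.1 hπ B hB u hu
  conv_rhs => rw [← h, Finset.sum_map]
  rfl

variable {x : Fin T → EuclideanSpace ℝ (Fin m)}

/-- Sampling without replacement from a centred family is negatively correlated. -/
theorem sum_inner_groupedPerms_nonpos (hB : B ∈ P.parts) (hx : ∑ u ∈ B, x u = 0) {u u' : Fin T}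
    (hu : u ∈ B) (hu' : u' ∈ B) (hne : u' ≠ u) :
    ∑ π ∈ groupedPerms P, inner ℝ (x (π u)) (x (π u')) ≤ 0 := by
  -- All positions other than `u` have the same correlation with `u`; as the family sums to zero,
  -- these correlations add up to minus the variance.
  have hswap : ∀ w ∈ B.erase u, ∑ π ∈ groupedPerms P, inner ℝ (x (π u)) (x (π w))
      = ∑ π ∈ groupedPerms P, inner ℝ (x (π u)) (x (π u')) := fun w hw => by
    rw [← sum_groupedPerms_mul_swap hB hu' (Finset.mem_of_mem_erase hw)]
    refine Finset.sum_congr rfl fun π _ => ?_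
    rw [Equiv.Perm.mul_apply, Equiv.Perm.mul_apply, Equiv.swap_apply_right,
      Equiv.swap_apply_of_ne_of_ne hne.symm (Finset.ne_of_mem_erase hw).symm]
  have hsum : ∑ w ∈ B.erase u, ∑ π ∈ groupedPerms P, inner ℝ (x (π u)) (x (π w))
      = - ∑ π ∈ groupedPerms P, ‖x (π u)‖ ^ 2 := by
    rw [Finset.sum_comm, ← Finset.sum_neg_distrib]
    refine Finset.sum_congr rfl fun π hπ => ?_
    have h := sum_comp_groupedPerm hB hπ x
    rw [hx, ← Finset.add_sum_erase B _ hu] at h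
    rw [← inner_sum, eq_neg_of_add_eq_zero_right h, inner_neg_right, real_inner_self_eq_norm_sq]
  rw [Finset.sum_congr rfl hswap, Finset.sum_const, nsmul_eq_mul] at hsum
  have hc : (0 : ℝ) < ((B.erase u).card : ℝ) :=
    Nat.cast_pos.2 (Finset.card_pos.2 ⟨u', Finset.mem_erase.2 ⟨hne, hu'⟩⟩)
  have hn : 0 ≤ ∑ π ∈ groupedPerms P, ‖x (π u)‖ ^ 2 := Finset.sum_nonneg fun _ _ => sq_nonneg _
  by_contra! hcon
  nlinarith [mul_pos hc hcon]

/-- Expand the square: off-diagonal terms are nonpositive on average, so only the diagonal counts.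
-/
theorem sum_norm_sq_groupedPerms_le (hB : B ∈ P.parts) (hx : ∑ u ∈ B, x u = 0) {D : ℝ}
    (hD : ∀ u ∈ B, ‖x u‖ ≤ D) {U : Finset (Fin T)} (hU : U ⊆ B) :
    ∑ π ∈ groupedPerms P, ‖∑ u ∈ U, x (π u)‖ ^ 2
      ≤ (groupedPerms P).card * (U.card * D ^ 2) := by
  have h1 : ∀ π : Equiv.Perm (Fin T), ‖∑ u ∈ U, x (π u)‖ ^ 2
      = ∑ u ∈ U, ∑ u' ∈ U, inner ℝ (x (π u)) (x (π u')) := fun π => by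
    rw [← real_inner_self_eq_norm_sq, sum_inner]
    simp_rw [inner_sum]
  simp_rw [h1]
  rw [Finset.sum_comm]
  calc ∑ u ∈ U, ∑ π ∈ groupedPerms P, ∑ u' ∈ U, inner ℝ (x (π u)) (x (π u'))
      ≤ ∑ u ∈ U, ((groupedPerms P).card * D ^ 2) := by
        refine Finset.sum_le_sum fun u hu => ?_
        rw [Finset.sum_comm, ← Finset.add_sum_erase U _ hu]
        have h2 : ∑ π ∈ groupedPerms P, inner ℝ (x (π u)) (x (π u))
            ≤ (groupedPerms P).card * D ^ 2 := by
          rw [← nsmul_eq_mul]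
          refine Finset.sum_le_card_nsmul _ _ _ fun π hπ => ?_
          rw [real_inner_self_eq_norm_sq]
          exact pow_le_pow_left₀ (norm_nonneg _)
            (hD _ (mem_groupedPerms.1 hπ B hB u (hU hu))) 2
        have h3 : ∑ u' ∈ U.erase u, ∑ π ∈ groupedPerms P, inner ℝ (x (π u)) (x (π u')) ≤ 0 :=
          Finset.sum_nonpos fun u' hu' => sum_inner_groupedPerms_nonpos hB hx (hU hu)
            (hU (Finset.mem_of_mem_erase hu')) (Finset.ne_of_mem_erase hu')
        linarith
    _ = _ := by rw [Finset.sum_const, nsmul_eq_mul]; ring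

theorem sum_norm_groupedPerms_le (hB : B ∈ P.parts) (hx : ∑ u ∈ B, x u = 0) {D : ℝ} (hD0 : 0 ≤ D)
    (hD : ∀ u ∈ B, ‖x u‖ ≤ D) {U : Finset (Fin T)} (hU : U ⊆ B) :
    ∑ π ∈ groupedPerms P, ‖∑ u ∈ U, x (π u)‖
      ≤ (groupedPerms P).card * (Real.sqrt U.card * D) := by
  refine le_of_sq_le_sq ?_ (by positivity)
  calc (∑ π ∈ groupedPerms P, ‖∑ u ∈ U, x (π u)‖) ^ 2
      ≤ (groupedPerms P).card * ∑ π ∈ groupedPerms P, ‖∑ u ∈ U, x (π u)‖ ^ 2 :=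
        sq_sum_le_card_mul_sum_sq
    _ ≤ (groupedPerms P).card * ((groupedPerms P).card * (U.card * D ^ 2)) := by
        gcongr; exact sum_norm_sq_groupedPerms_le hB hx hD hU
    _ = _ := by
        rw [mul_pow, mul_pow, Real.sq_sqrt (Nat.cast_nonneg _)]; ring

/-- A centred sample is nearly orthogonal, on average, to any bounded vector determined by the
past. -/
theorem sum_inner_past_le (hB : B ∈ P.parts) (hx : ∑ u ∈ B, x u = 0) {D R : ℝ} (hD0 : 0 ≤ D)
    (hD : ∀ u ∈ B, ‖x u‖ ≤ D) {t : Fin T} (ht : t ∈ B)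
    {q : Equiv.Perm (Fin T) → EuclideanSpace ℝ (Fin m)} (hR0 : 0 ≤ R)
    (hR : ∀ π ∈ groupedPerms P, ‖q π‖ ≤ R)
    (hq : ∀ π ∈ groupedPerms P, ∀ π' ∈ groupedPerms P, (∀ s < t, π s = π' s) → q π = q π') :
    ∑ π ∈ groupedPerms P, inner ℝ (q π) (x (π t))
      ≤ (groupedPerms P).card * (R * D * (1 / Real.sqrt ((B.filter (t ≤ ·)).card : ℝ))) := by
  set U := B.filter (t ≤ ·) with hUdef
  have hU : U ⊆ B := Finset.filter_subset _ _
  have hUpos : (0 : ℝ) < U.card :=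
    Nat.cast_pos.2 (Finset.card_pos.2 ⟨t, Finset.mem_filter.2 ⟨ht, le_rfl⟩⟩)
  -- Swapping `t` with a later position of `B` leaves the past, hence `q`, unchanged.
  have hswap : ∀ u ∈ U, ∑ π ∈ groupedPerms P, inner ℝ (q π) (x (π u))
      = ∑ π ∈ groupedPerms P, inner ℝ (q π) (x (π t)) := fun u hu => by
    obtain ⟨huB, htu⟩ := Finset.mem_filter.1 hu
    rw [← sum_groupedPerms_mul_swap hB ht huB]
    refine Finset.sum_congr rfl fun π hπ => ?_
    rw [Equiv.Perm.mul_apply, Equiv.swap_apply_right,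
      hq _ (mul_swap_mem_groupedPerms hB ht huB hπ) π hπ fun s hs => ?_]
    rw [Equiv.Perm.mul_apply, Equiv.swap_apply_of_ne_of_ne hs.ne (hs.trans_le htu).ne]
  have hsum : (U.card : ℝ) * ∑ π ∈ groupedPerms P, inner ℝ (q π) (x (π t))
      = ∑ π ∈ groupedPerms P, inner ℝ (q π) (∑ u ∈ U, x (π u)) := by
    rw [← nsmul_eq_mul, ← Finset.sum_const, ← Finset.sum_congr rfl hswap, Finset.sum_comm]
    simp_rw [inner_sum]
  have hle : ∑ π ∈ groupedPerms P, inner ℝ (q π) (∑ u ∈ U, x (π u))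
      ≤ R * ((groupedPerms P).card * (Real.sqrt U.card * D)) :=
    calc _ ≤ ∑ π ∈ groupedPerms P, R * ‖∑ u ∈ U, x (π u)‖ :=
          Finset.sum_le_sum fun π hπ => (real_inner_le_norm _ _).trans
            (mul_le_mul_of_nonneg_right (hR π hπ) (norm_nonneg _))
      _ = R * ∑ π ∈ groupedPerms P, ‖∑ u ∈ U, x (π u)‖ := by rw [Finset.mul_sum]
      _ ≤ _ := mul_le_mul_of_nonneg_left (sum_norm_groupedPerms_le hB hx hD0 hD hU) hR0
  rw [← hsum, ← le_div_iff₀' hUpos] at hle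
  refine hle.trans_eq ?_
  have hs := Real.mul_self_sqrt hUpos.le
  have hs0 : Real.sqrt (U.card : ℝ) ≠ 0 := (Real.sqrt_pos.2 hUpos).ne'
  rw [div_eq_iff hUpos.ne']
  nth_rewrite 3 [← hs]
  field_simp

end GroupedPerms

/-! ### Analysis of a single run -/

section Run

variable {I : ODMP m T} {dy dr du : ℝ} {π : Equiv.Perm (Fin T)}
  {ω : (t : Fin T) → Decision m (I.dim (π t))} {v : Fin T → EuclideanSpace ℝ (Fin m)}
  {p : Fin (T + 1) → EuclideanSpace ℝ (Fin m)}

theorem IsRun.mem_polarCone (h : I.IsRun π ω v p) (t : Fin (T + 1)) : p t ∈ polarCone I.C := by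
  cases t using Fin.cases with
  | zero => rw [h.init]; exact zero_mem_polarCone _
  | succ t => exact (h.update t).1

theorem IsRun.norm_subgradient_le (h : I.IsRun π ω v p) (hdy : 0 ≤ dy)
    (h2 : I.AssumptionA2 dy dr du) (t : Fin T) : ‖v t - (ω t).2.2‖ ≤ Real.sqrt m * dy := by
  rw [norm_sub_rev]
  exact norm_sub_le_of_coord hdy (h2.impact_bound _ _ (h.local_mem t) _ (h.support_mem t))

theorem IsRun.norm_step_le (h : I.IsRun π ω v p) (hm : 1 ≤ m) (hdy : 0 ≤ dy)
    (h2 : I.AssumptionA2 dy dr du) (t : Fin T) :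
    ‖p t.succ - p t.castSucc‖ ≤ Real.sqrt m * dy * stepSize m (t.val + 1) := by
  have h1 := (h.update t).norm_sub_le (convex_polarCone _) (h.mem_polarCone t.castSucc)
  have hη := stepSize_pos hm (Nat.le_add_left 1 t.val)
  rw [sub_sub_cancel_left, norm_neg, norm_smul, Real.norm_of_nonneg hη.le] at h1
  have := mul_le_mul_of_nonneg_left (h.norm_subgradient_le hdy h2 t) hη.le
  linarith

theorem IsRun.norm_sq_succ_le (h : I.IsRun π ω v p) (hdy : 0 ≤ dy)
    (h2 : I.AssumptionA2 dy dr du) (t : Fin T) :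
    ‖p t.succ‖ ^ 2 ≤ ‖p t.castSucc‖ ^ 2
      + stepSize m (t.val + 1) * (stepSize m (t.val + 1) * m * dy ^ 2
        - 2 * inner ℝ (p t.castSucc) (v t - (ω t).2.2)) := by
  have h1 := (h.update t).norm_sub_sq_le (convex_polarCone _) (zero_mem_polarCone _)
  rw [sub_zero, sub_zero, norm_sub_sq_real, real_inner_smul_right, norm_smul, mul_pow,
    Real.norm_eq_abs, sq_abs] at h1
  have h3 := pow_le_pow_left₀ (norm_nonneg _) (h.norm_subgradient_le hdy h2 t) 2
  rw [mul_pow, Real.sq_sqrt (Nat.cast_nonneg _)] at h3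
  have := mul_le_mul_of_nonneg_left h3 (sq_nonneg (stepSize m (t.val + 1)))
  nlinarith

theorem IsRun.local_opt_convexHull (h : I.IsRun π ω v p) (t : Fin T)
    {ω' : Decision m (I.dim (π t))} (hω' : ω' ∈ convexHull ℝ (I.Z (π t))) :
    ω'.1 - inner ℝ (p t.castSucc) ω'.2.2
      ≤ (ω t).1 - inner ℝ (p t.castSucc) (ω t).2.2 := by
  have hconv : Convex ℝ {ω' : Decision m (I.dim (π t)) |
      ω'.1 - inner ℝ (p t.castSucc) ω'.2.2
        ≤ (ω t).1 - inner ℝ (p t.castSucc) (ω t).2.2} := by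
    intro x hx y hy a b ha hb hab
    simp only [Set.mem_ofPred_eq, Prod.fst_add, Prod.snd_add, Prod.smul_fst, Prod.smul_snd,
      inner_add_right, real_inner_smul_right, smul_eq_mul] at hx hy ⊢
    have h1 := mul_le_mul_of_nonneg_left hx ha
    have h2 := mul_le_mul_of_nonneg_left hy hb
    obtain rfl : b = 1 - a := by linarith
    linarith
  exact convexHull_min (fun z hz => h.local_opt t z hz) hconv hω'

theorem IsRun.inner_goalSet_le (h : I.IsRun π ω v p) (t : Fin T)
    {w : EuclideanSpace ℝ (Fin m)} (hw : w ∈ I.goalSet) :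
    inner ℝ (p t.castSucc) w ≤ inner ℝ (p t.castSucc) (v t) := by
  obtain ⟨q, hq, c, hc, rfl⟩ := hw
  have h1 := h.support_opt t q hq
  have h2 := h.mem_polarCone t.castSucc c hc
  rw [inner_add_right]
  linarith

/-- Compare with the strongly feasible decision: its ball lets the goal point move by `du` in the
direction of the multiplier, which gains `du * ‖p‖`, while its reward loses at most `dr`. -/
theorem IsRun.inner_subgradient_ge (h : I.IsRun π ω v p) (hdu : 0 < du)
    (h2 : I.AssumptionA2 dy dr du) (t : Fin T) :
    du * ‖p t.castSucc‖ - dr ≤ inner ℝ (p t.castSucc) (v t - (ω t).2.2) := by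
  obtain ⟨z, hz, hr, hball⟩ := h2.strongly_feasible (π t)
  have h1 := h.local_opt_convexHull t hz
  have h3 := hr _ (h.local_mem t)
  set q := p t.castSucc with hq
  -- For `q = 0` the quotient is `0` and the point is the centre of the ball.
  have hmem : z.2.2 + (du / ‖q‖) • q ∈ Metric.closedBall z.2.2 du := by
    rw [mem_closedBall_iff_norm, add_sub_cancel_left, norm_smul, norm_div, norm_norm,
      Real.norm_of_nonneg hdu.le]
    rcases eq_or_ne ‖q‖ 0 with h0 | h0
    · simp [h0, hdu.le]
    · rw [div_mul_cancel₀ _ h0]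
  have h4 := h.inner_goalSet_le t (hball hmem)
  rw [← hq, inner_add_right, real_inner_smul_right, real_inner_self_eq_norm_sq] at h4
  have h5 : du / ‖q‖ * ‖q‖ ^ 2 = du * ‖q‖ := by
    rcases eq_or_ne ‖q‖ 0 with h0 | h0
    · simp [h0]
    · field_simp
  rw [inner_sub_right]
  linarith

/-- Strong feasibility keeps the multipliers in a ball whose radius does not depend on `m`. -/
theorem IsRun.norm_le (h : I.IsRun π ω v p) (hm : 1 ≤ m) (hdy : 0 ≤ dy) (hdr : 0 ≤ dr)
    (hdu : 0 < du) (h2 : I.AssumptionA2 dy dr du) (t : Fin (T + 1)) :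
    ‖p t‖ ≤ (2 * dr + dy ^ 2) / (2 * du) + dy := by
  have hM : 0 ≤ (2 * dr + dy ^ 2) / (2 * du) := by positivity
  induction t using Fin.induction with
  | zero => rw [h.init, norm_zero]; positivity
  | succ t ih =>
    have hη := stepSize_pos hm (Nat.le_add_left 1 t.val)
    have hηm := stepSize_mul_le_one hm (t.val + 1)
    -- Below the threshold one step adds at most `dy`; above it the drift towards the origin
    -- outweighs the quadratic term, so the norm does not grow.
    rcases le_total ‖p t.castSucc‖ ((2 * dr + dy ^ 2) / (2 * du)) with hle | hge
    · have h3 := h.norm_step_le hm hdy h2 t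
      have h4 : Real.sqrt m * dy * stepSize m (t.val + 1) ≤ dy :=
        calc _ = (Real.sqrt m * stepSize m (t.val + 1)) * dy := by ring
          _ ≤ 1 * dy := by
            refine mul_le_mul_of_nonneg_right ?_ hdy
            nlinarith [sqrt_le_self_natCast hm]
          _ = dy := one_mul _
      have h5 := norm_le_norm_add_norm_sub' (p t.succ) (p t.castSucc)
      linarith
    · refine le_trans (le_of_sq_le_sq ?_ (norm_nonneg _)) ih
      have h3 := h.norm_sq_succ_le hdy h2 t
      have h4 := h.inner_subgradient_ge hdu h2 t
      rw [div_le_iff₀ (by positivity)] at hge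
      have h5 := mul_le_mul_of_nonneg_right hηm (sq_nonneg dy)
      have h6 : stepSize m (t.val + 1) * (stepSize m (t.val + 1) * m * dy ^ 2
        - 2 * inner ℝ (p t.castSucc) (v t - (ω t).2.2)) ≤ 0 :=
        mul_nonpos_of_nonneg_of_nonpos hη.le (by linarith)
      linarith

theorem norm_sub_le_mul_stepDist {L : ℝ}
    (hstep : ∀ t : Fin T, ‖p t.succ - p t.castSucc‖ ≤ L * stepSize m (t.val + 1)) (i j : Fin T) :
    ‖p i.castSucc - p j.castSucc‖ ≤ L * stepDist m i j := by
  have key : ∀ i j : ℕ, i ≤ j → ∀ (hi : i < T + 1) (hj : j < T + 1),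
      ‖p ⟨j, hj⟩ - p ⟨i, hi⟩‖ ≤ L * ∑ t ∈ Finset.Ico (i + 1) (j + 1), stepSize m t := by
    intro i j hij
    induction j, hij using Nat.le_induction with
    | base => intro hi hj; simp
    | succ j hij ih =>
      intro hi hj
      rw [Finset.sum_Ico_succ_top (by omega), mul_add]
      have h1 := ih hi (by omega)
      have h2 := hstep ⟨j, by omega⟩
      exact (norm_sub_le_norm_sub_add_norm_sub _ (p ⟨j, by omega⟩) _).trans
        ((add_comm _ _).trans_le (add_le_add h1 h2))
  unfold stepDist
  split_ifs with hij
  · rw [norm_sub_rev]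
    exact key i j hij.le _ _
  · exact key j i (not_lt.1 hij) _ _

/-- Divide the recursion for `‖p‖ ^ 2` by twice the stepsize and sum by parts; the weights increase
because the stepsizes decrease. -/
theorem IsRun.sum_inner_subgradient_le (h : I.IsRun π ω v p) (hm : 1 ≤ m) (hT : m ≤ T)
    (hdy : 0 ≤ dy) (h2 : I.AssumptionA2 dy dr du) {R : ℝ} (hR : ∀ t, ‖p t‖ ≤ R) :
    ∑ t, inner ℝ (p t.castSucc) (v t - (ω t).2.2)
      ≤ (R ^ 2 + dy ^ 2) * Real.sqrt (m * T) := by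
  -- The path is frozen after index `T` to make it a sequence on `ℕ`.
  let N : ℕ → ℝ := fun i => ‖p ⟨min i T, by omega⟩‖ ^ 2
  let a : ℕ → ℝ := fun i => 1 / stepSize m (i + 1) / 2
  have ha : ∀ i, 0 < a i := fun i => by
    have := stepSize_pos hm (Nat.le_add_left 1 i)
    positivity
  have hN : ∀ i, N i ≤ R ^ 2 := fun i => pow_le_pow_left₀ (norm_nonneg _) (hR _) 2
  have h3 := sum_mul_sub_ge (a := a) (P := N) T (ha 0).le
    (fun i _ => by
      have := stepSize_antitone hm (Nat.le_add_left 1 i) (Nat.le_succ (i + 1))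
      have := one_div_le_one_div_of_le (stepSize_pos hm (Nat.le_add_left 1 (i + 1))) this
      simp only [a]
      linarith) (fun i _ => hN i)
  have h4 : ∀ t : Fin T, inner ℝ (p t.castSucc) (v t - (ω t).2.2)
      ≤ stepSize m (t.val + 1) * m * (dy ^ 2 / 2) - a t * (N (t + 1) - N t) := fun t => by
    have hη := stepSize_pos hm (Nat.le_add_left 1 t.val)
    have e1 : N (t + 1) = ‖p t.succ‖ ^ 2 := by
      simp only [N]; congr 3; ext; simp
    have e2 : N t = ‖p t.castSucc‖ ^ 2 := by
      simp only [N]; congr 3; ext; simp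
    have h5 := h.norm_sq_succ_le hdy h2 t
    rw [← e1, ← e2, ← sub_le_iff_le_add'] at h5
    have h6 : a t * (N (t + 1) - N t) ≤ (stepSize m (t.val + 1) * m * dy ^ 2
        - 2 * inner ℝ (p t.castSucc) (v t - (ω t).2.2)) / 2 := by
      refine (mul_le_mul_of_nonneg_left h5 (ha t).le).trans_eq ?_
      simp only [a]
      field_simp
    linarith
  have h7 := Finset.sum_le_sum fun t (_ : t ∈ Finset.univ) => h4 t
  rw [Finset.sum_sub_distrib, Fin.sum_univ_eq_sum_range (fun t => a t * (N (t + 1) - N t)),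
    ← Finset.sum_mul, Fin.sum_univ_eq_sum_range (fun t => stepSize m (t + 1) * m)] at h7
  have h8 := mul_le_mul_of_nonneg_right (sum_stepSize_le hm T)
    (show 0 ≤ dy ^ 2 / 2 by positivity)
  have h9 : -(Real.sqrt (m * T) * R ^ 2) ≤ a T * (N T - R ^ 2) := by
    have h10 : a T ≤ Real.sqrt (m * T) := by
      have := one_div_stepSize_succ_le hm hT
      simp only [a]; linarith
    have h11 : 0 ≤ N T := sq_nonneg _
    nlinarith [mul_le_mul_of_nonneg_right h10 (sq_nonneg R), mul_nonneg (ha T).le h11]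
  linarith

theorem IsRun.reward_ge (h : I.IsRun π ω v p) (hm : 1 ≤ m) (hT : m ≤ T)
    (hdy : 0 ≤ dy) (h2 : I.AssumptionA2 dy dr du) {R : ℝ} (hR : ∀ t, ‖p t‖ ≤ R)
    {z : (s : Fin T) → Decision m (I.dim s)} (hz : ∀ s, z s ∈ convexHull ℝ (I.Z s))
    {w : EuclideanSpace ℝ (Fin m)} (hw : w ∈ I.goalSet) :
    ∑ s, (z s).1 + ∑ t, inner ℝ (p t.castSucc) (w - (z (π t)).2.2)
      - (R ^ 2 + dy ^ 2) * Real.sqrt (m * T) ≤ I.reward π ω := by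
  have h1 := h.sum_inner_subgradient_le hm hT hdy h2 hR
  have h3 : ∑ t, ((z (π t)).1 + inner ℝ (p t.castSucc) (w - (z (π t)).2.2))
      ≤ ∑ t, ((ω t).1 + inner ℝ (p t.castSucc) (v t - (ω t).2.2)) :=
    Finset.sum_le_sum fun t _ => by
      have h4 := h.local_opt_convexHull t (hz (π t))
      have h5 := h.inner_goalSet_le t hw
      rw [inner_sub_right, inner_sub_right]
      linarith
  rw [Finset.sum_add_distrib, Finset.sum_add_distrib,
    Equiv.sum_comp π fun s => (z s).1] at h3
  unfold reward
  linarith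

end Run

/-! ### Dependence of the multipliers on the past only -/

theorem IsOnlineExecution.multiplier_eq {I : ODMP m T}
    {P : Finpartition (Finset.univ : Finset (Fin T))}
    {ω : (π : Equiv.Perm (Fin T)) → (t : Fin T) → Decision m (I.dim (π t))}
    {v : Equiv.Perm (Fin T) → Fin T → EuclideanSpace ℝ (Fin m)}
    {p : Equiv.Perm (Fin T) → Fin (T + 1) → EuclideanSpace ℝ (Fin m)}
    (h : I.IsOnlineExecution P ω v p) {π π' : Equiv.Perm (Fin T)} (hπ : π ∈ groupedPerms P)
    (hπ' : π' ∈ groupedPerms P) (k : Fin (T + 1))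
    (hk : ∀ s : Fin T, s.castSucc < k → π s = π' s) : p π k = p π' k := by
  induction k using Fin.induction with
  | zero => rw [(h.run π hπ).init, (h.run π' hπ').init]
  | succ t ih =>
    have h1 := ih fun s hs => hk s (hs.trans (Fin.castSucc_lt_succ))
    obtain ⟨h2, h3⟩ := h.nonanticipating π hπ π' hπ' t fun s hs =>
      hk s (Fin.castSucc_lt_succ_iff.2 hs)
    have h4 : (ω π t).2.2 = (ω π' t).2.2 :=
      congrArg (fun q : (s : Fin T) × Decision m (I.dim s) => q.2.2.2) h2
    have h5 := (h.run π hπ).update t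
    rw [h1, h3, h4] at h5
    exact h5.unique (convex_polarCone _) ((h.run π' hπ').update t)

/-! ### Transport bound for Lipschitz functions -/

section Wasserstein

/-- The easy half of Kantorovich–Rubinstein duality: the marginals of a coupling `q` write the
difference of averages as `∑ q i j • (f i - f j)`. -/
theorem norm_average_sub_le_wasserstein {B : Finset (Fin T)} (hB : B.Nonempty) {L : ℝ}
    (hL : 0 < L) {f : Fin T → EuclideanSpace ℝ (Fin m)}
    (hf : ∀ i j, ‖f i - f j‖ ≤ L * stepDist m i j) :
    ‖(1 / (B.card : ℝ)) • ∑ i ∈ B, f i - (1 / (T : ℝ)) • ∑ j, f j‖ ≤ L * wasserstein m B := by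
  have hBc : (B.card : ℝ) ≠ 0 := Nat.cast_ne_zero.2 (Finset.card_pos.2 hB).ne'
  have hTc : (T : ℝ) ≠ 0 := by
    obtain ⟨t, _⟩ := hB
    exact Nat.cast_ne_zero.2 t.pos.ne'
  rw [← div_le_iff₀' hL]
  -- The product coupling shows that the infimum is over a nonempty set.
  refine le_csInf ⟨_, fun _ _ => 1 / ((B.card : ℝ) * T), fun _ _ => by positivity,
    fun _ => ?_, fun _ => ?_, rfl⟩ ?_
  · simp; field_simp
  · simp; field_simp
  rintro _ ⟨q, hq, hq1, hq2, rfl⟩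
  rw [div_le_iff₀' hL]
  have e : (1 / (B.card : ℝ)) • ∑ i ∈ B, f i - (1 / (T : ℝ)) • ∑ j, f j
      = ∑ i : B, ∑ j, q i j • (f i - f j) := by
    simp_rw [smul_sub, Finset.sum_sub_distrib]
    congr 1
    · rw [← Finset.sum_coe_sort, Finset.smul_sum]
      refine Finset.sum_congr rfl fun i _ => ?_
      rw [← Finset.sum_smul, hq2]
    · rw [Finset.sum_comm, Finset.smul_sum]
      refine Finset.sum_congr rfl fun j _ => ?_
      rw [← Finset.sum_smul, hq1]
  rw [e, Finset.mul_sum]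
  refine norm_sum_le_of_le _ fun i _ => ?_
  rw [Finset.mul_sum]
  refine norm_sum_le_of_le _ fun j _ => ?_
  rw [norm_smul, Real.norm_of_nonneg (hq i j)]
  have := mul_le_mul_of_nonneg_left (hf i j) (hq i j)
  linarith

end Wasserstein

/-! ### Combining the two error terms -/

section Main

theorem sum_parts_sum {M : Type*} [AddCommMonoid M]
    (P : Finpartition (Finset.univ : Finset (Fin T))) (f : Fin T → M) :
    ∑ B ∈ P.parts, ∑ t ∈ B, f t = ∑ t, f t := by
  conv_rhs => rw [← P.biUnion_parts]
  exact (Finset.sum_biUnion P.supIndep.pairwiseDisjoint).symm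

theorem card_ne_zero_of_mem_parts {P : Finpartition (Finset.univ : Finset (Fin T))}
    {B : Finset (Fin T)} (hB : B ∈ P.parts) : (B.card : ℝ) ≠ 0 :=
  Nat.cast_ne_zero.2 (Finset.card_pos.2 (P.nonempty_of_mem_parts hB)).ne'

theorem wasserstein_nonneg (B : Finset (Fin T)) : 0 ≤ wasserstein m B := by
  have hη : ∀ t, 0 ≤ stepSize m t := fun t => by unfold stepSize; positivity
  refine Real.sInf_nonneg ?_
  rintro _ ⟨q, hq, -, -, rfl⟩
  refine Finset.sum_nonneg fun i _ => Finset.sum_nonneg fun j _ => mul_nonneg ?_ (hq i j)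
  unfold stepDist
  split_ifs <;> exact Finset.sum_nonneg fun t _ => hη t

theorem unevenness_nonneg (P : Finpartition (Finset.univ : Finset (Fin T))) :
    0 ≤ unevenness m P :=
  Finset.sum_nonneg fun B _ => mul_nonneg (by positivity) (wasserstein_nonneg B)

/-- The average of `y` over the finite set `B`. -/
noncomputable def average (B : Finset (Fin T)) (y : Fin T → EuclideanSpace ℝ (Fin m)) :
    EuclideanSpace ℝ (Fin m) :=
  (1 / (B.card : ℝ)) • ∑ s ∈ B, y s

theorem card_smul_average {B : Finset (Fin T)} (hB : (B.card : ℝ) ≠ 0)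
    (y : Fin T → EuclideanSpace ℝ (Fin m)) : (B.card : ℝ) • average B y = ∑ s ∈ B, y s := by
  rw [average, smul_smul, mul_one_div_cancel hB, one_smul]

theorem sum_sub_average {B : Finset (Fin T)} (hB : (B.card : ℝ) ≠ 0)
    (y : Fin T → EuclideanSpace ℝ (Fin m)) : ∑ s ∈ B, (y s - average B y) = 0 := by
  rw [Finset.sum_sub_distrib, Finset.sum_const, ← Nat.cast_smul_eq_nsmul ℝ,
    card_smul_average hB, sub_self]

theorem norm_average_sub_le {B : Finset (Fin T)} (hB : (B.card : ℝ) ≠ 0)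
    {y : Fin T → EuclideanSpace ℝ (Fin m)} {a : EuclideanSpace ℝ (Fin m)} {L : ℝ}
    (hy : ∀ s, ‖y s - a‖ ≤ L) : ‖average B y - a‖ ≤ L := by
  have e : average B y - a = (1 / (B.card : ℝ)) • ∑ s ∈ B, (y s - a) := by
    rw [Finset.sum_sub_distrib, smul_sub, Finset.sum_const, ← Nat.cast_smul_eq_nsmul ℝ, smul_smul,
      one_div_mul_cancel hB, one_smul, average]
  rw [e, norm_smul, Real.norm_of_nonneg (by positivity), one_div, inv_mul_le_iff₀ (by positivity)]
  exact (norm_sum_le_of_le _ fun s _ => hy s).trans_eq (by simp)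

/-- Replacing the group averages by the overall average costs at most the unevenness. -/
theorem sum_inner_sub_average_ge (P : Finpartition (Finset.univ : Finset (Fin T))) {L D : ℝ}
    (hL : 0 < L) {f y : Fin T → EuclideanSpace ℝ (Fin m)}
    (hf : ∀ i j, ‖f i - f j‖ ≤ L * stepDist m i j) {w : EuclideanSpace ℝ (Fin m)}
    (hw : (T : ℝ) • w = ∑ s, y s) (hD : ∀ B ∈ P.parts, ‖w - average B y‖ ≤ D) :
    -(L * D * ∑ B ∈ P.parts, (B.card : ℝ) * wasserstein m B)
      ≤ ∑ B ∈ P.parts, ∑ t ∈ B, inner ℝ (f t) (w - average B y) := by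
  set fbar := (1 / (T : ℝ)) • ∑ j, f j with hfbar
  -- The deviations, weighted by group size, cancel, so the overall mean multiplier can be
  -- subtracted for free.
  have hzero : ∑ B ∈ P.parts, (B.card : ℝ) * inner ℝ fbar (w - average B y) = 0 := by
    have h1 : ∑ B ∈ P.parts, (B.card : ℝ) • (w - average B y) = 0 := by
      simp_rw [smul_sub]
      rw [Finset.sum_sub_distrib, Finset.sum_congr rfl fun B hB =>
        card_smul_average (card_ne_zero_of_mem_parts hB) y, sum_parts_sum, ← hw,
        ← Finset.sum_smul, ← Nat.cast_sum, P.sum_card_parts, Finset.card_univ, Fintype.card_fin,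
        sub_self]
    simp_rw [← real_inner_smul_right]
    rw [← inner_sum, h1, inner_zero_right]
  rw [← sub_zero (∑ B ∈ P.parts, ∑ t ∈ B, _), ← hzero, ← Finset.sum_sub_distrib, Finset.mul_sum,
    ← Finset.sum_neg_distrib]
  refine Finset.sum_le_sum fun B hB => ?_
  have hBc := card_ne_zero_of_mem_parts hB
  have e : ∑ t ∈ B, inner ℝ (f t) (w - average B y)
      - (B.card : ℝ) * inner ℝ fbar (w - average B y)
      = (B.card : ℝ) * inner ℝ ((1 / (B.card : ℝ)) • ∑ i ∈ B, f i - fbar)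
        (w - average B y) := by
    rw [inner_sub_left, real_inner_smul_left (∑ i ∈ B, f i), ← sum_inner, mul_sub, ← mul_assoc,
      mul_one_div_cancel hBc, one_mul]
  rw [e]
  have h1 := norm_average_sub_le_wasserstein (P.nonempty_of_mem_parts hB) hL hf
  have h2 := (abs_le.1 (abs_real_inner_le_norm ((1 / (B.card : ℝ)) • ∑ i ∈ B, f i - fbar)
    (w - average B y))).1
  have h3 := mul_le_mul h1 (hD B hB) (norm_nonneg _)
    (mul_nonneg hL.le (wasserstein_nonneg B))
  have h4 := mul_le_mul_of_nonneg_left ((neg_le_neg h3).trans h2) (Nat.cast_nonneg B.card)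
  refine le_trans (le_of_eq ?_) h4
  ring

/-- Within the groups, sampling without replacement costs at most `∑ √|B|`, up to a factor. -/
theorem sum_inner_centered_le {P : Finpartition (Finset.univ : Finset (Fin T))} {R D : ℝ}
    (hR0 : 0 ≤ R) (hD0 : 0 ≤ D) {y : Fin T → EuclideanSpace ℝ (Fin m)}
    (hD : ∀ B ∈ P.parts, ∀ s, ‖y s - average B y‖ ≤ D)
    {q : Equiv.Perm (Fin T) → Fin T → EuclideanSpace ℝ (Fin m)}
    (hR : ∀ π ∈ groupedPerms P, ∀ t, ‖q π t‖ ≤ R)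
    (hq : ∀ t, ∀ π ∈ groupedPerms P, ∀ π' ∈ groupedPerms P,
      (∀ s < t, π s = π' s) → q π t = q π' t) :
    ∑ π ∈ groupedPerms P, ∑ B ∈ P.parts, ∑ t ∈ B, inner ℝ (q π t) (y (π t) - average B y)
      ≤ (groupedPerms P).card * (2 * R * D * ∑ B ∈ P.parts, Real.sqrt (B.card : ℝ)) := by
  rw [Finset.sum_comm, Finset.mul_sum, Finset.mul_sum]
  refine Finset.sum_le_sum fun B hB => ?_
  rw [Finset.sum_comm]
  calc _ ≤ ∑ t ∈ B, (groupedPerms P).card *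
          (R * D * (1 / Real.sqrt ((B.filter (t ≤ ·)).card : ℝ))) :=
        Finset.sum_le_sum fun t ht => sum_inner_past_le (x := fun s => y s - average B y) hB
          (sum_sub_average (card_ne_zero_of_mem_parts hB) y) hD0 (fun u _ => hD B hB u) ht hR0
          (fun π hπ => hR π hπ t) (hq t)
    _ = (groupedPerms P).card * (R * D *
          ∑ t ∈ B, 1 / Real.sqrt ((B.filter (t ≤ ·)).card : ℝ)) := by
        rw [Finset.mul_sum, Finset.mul_sum]
    _ ≤ (groupedPerms P).card * (R * D * (2 * Real.sqrt (B.card : ℝ))) := by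
        gcongr; exact sum_inv_sqrt_card_le B
    _ = _ := by ring

theorem le_groupedExpectation {P : Finpartition (Finset.univ : Finset (Fin T))}
    {f : Equiv.Perm (Fin T) → ℝ} {a : ℝ}
    (h : (groupedPerms P).card * a ≤ ∑ π ∈ groupedPerms P, f π) : a ≤ groupedExpectation P f :=
  (le_div_iff₀' card_groupedPerms_pos).2 h

theorem abs_impact_sub_le {I : ODMP m T} {dy dr du : ℝ} (h2 : I.AssumptionA2 dy dr du)
    {s : Fin T} {z : Decision m (I.dim s)} (hz : z ∈ convexHull ℝ (I.Z s))
    {a : EuclideanSpace ℝ (Fin m)} (ha : a ∈ I.Q) (i : Fin m) : |z.2.2 i - a i| ≤ dy := by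
  have hconv : Convex ℝ {z : Decision m (I.dim s) | |z.2.2 i - a i| ≤ dy} := by
    have : {z : Decision m (I.dim s) | |z.2.2 i - a i| ≤ dy}
        = (fun z : Decision m (I.dim s) => z.2.2 i) ⁻¹' Metric.closedBall (a i) dy := by
      ext z; simp [Real.dist_eq]
    rw [this]
    exact (convex_closedBall _ _).is_linear_preimage
      ⟨fun x y => by simp, fun c x => by simp⟩
  exact convexHull_min (fun z hz => h2.impact_bound s z hz a ha i) hconv hz

/-- The Lipschitz constant `√m * d` of the multipliers times the bound `2√m * d` on deviations of
impacts yields the factor `m` in `W`. -/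
theorem mul_sum_wasserstein (P : Finpartition (Finset.univ : Finset (Fin T))) (d : ℝ) :
    Real.sqrt m * d * (2 * (Real.sqrt m * d)) * ∑ B ∈ P.parts, (B.card : ℝ) * wasserstein m B
      = 2 * d ^ 2 * unevenness m P := by
  have h1 : unevenness m P = m * ∑ B ∈ P.parts, (B.card : ℝ) * wasserstein m B := by
    rw [unevenness, Finset.mul_sum]
    exact Finset.sum_congr rfl fun B _ => mul_assoc _ _ _
  have h2 := Real.mul_self_sqrt (Nat.cast_nonneg (α := ℝ) m)
  rw [h1]
  linear_combination (2 * d ^ 2 * ∑ B ∈ P.parts, (B.card : ℝ) * wasserstein m B) * h2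

theorem reward_bound_of_feasible {dy dr du : ℝ} (hdy : 0 < dy) (hdr : 0 ≤ dr) (hdu : 0 < du)
    (hm : 1 ≤ m) (hT : m ≤ T) {I : ODMP m T} (h2 : I.AssumptionA2 dy dr du)
    {P : Finpartition (Finset.univ : Finset (Fin T))}
    {ω : (π : Equiv.Perm (Fin T)) → (t : Fin T) → Decision m (I.dim (π t))}
    {v : Equiv.Perm (Fin T) → Fin T → EuclideanSpace ℝ (Fin m)}
    {p : Equiv.Perm (Fin T) → Fin (T + 1) → EuclideanSpace ℝ (Fin m)}
    (h : I.IsOnlineExecution P ω v p) {R : ℝ} (hRdef : R = (2 * dr + dy ^ 2) / (2 * du) + dy)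
    {z : (s : Fin T) → Decision m (I.dim s)} (hz : ∀ s, z s ∈ convexHull ℝ (I.Z s))
    (hfeas : ∑ s, (z s).2.2 ∈ (T : ℝ) • I.goalSet) :
    ∑ s, (z s).1 - (R ^ 2 + dy ^ 2 + 4 * R * dy) *
        (Real.sqrt m * ∑ B ∈ P.parts, Real.sqrt (B.card : ℝ)) - 2 * dy ^ 2 * unevenness m P
      ≤ groupedExpectation P fun π => I.reward π (ω π) := by
  have hm0 : (0 : ℝ) < m := by exact_mod_cast hm
  have hT0 : (T : ℝ) ≠ 0 := by exact_mod_cast (by omega : T ≠ 0)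
  have hsm : 0 < Real.sqrt (m : ℝ) := Real.sqrt_pos.2 hm0
  have hL : 0 < Real.sqrt m * dy := mul_pos hsm hdy
  have hR0 : 0 ≤ R := by rw [hRdef]; positivity
  obtain ⟨w, hw, hwsum⟩ := hfeas
  simp only at hwsum
  set y : Fin T → EuclideanSpace ℝ (Fin m) := fun s => (z s).2.2 with hy
  -- A point of `Q` serves as common centre: all `y s`, their group means and `w` lie within `√m *
  -- dy` of it.
  obtain ⟨a, ha, -⟩ := id hw
  have hya : ∀ s, ‖y s - a‖ ≤ Real.sqrt m * dy := fun s =>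
    norm_sub_le_of_coord hdy.le (abs_impact_sub_le h2 (hz s) ha)
  have hBa : ∀ B ∈ P.parts, ‖average B y - a‖ ≤ Real.sqrt m * dy := fun B hB =>
    norm_average_sub_le (card_ne_zero_of_mem_parts hB) hya
  have hwa : ‖w - a‖ ≤ Real.sqrt m * dy := by
    have : w = average Finset.univ y := by
      rw [average, ← hwsum, smul_smul, Finset.card_univ, Fintype.card_fin,
        one_div_mul_cancel hT0, one_smul]
    rw [this]
    exact norm_average_sub_le (by simpa using hT0) hya
  have hR : ∀ π ∈ groupedPerms P, ∀ t, ‖p π t‖ ≤ R := fun π hπ t =>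
    hRdef ▸ (h.run π hπ).norm_le hm hdy.le hdr hdu h2 t
  have hcenter := sum_inner_centered_le (P := P) (D := 2 * (Real.sqrt m * dy))
    (q := fun π t => p π t.castSucc) hR0 (by positivity)
    (fun B hB s => (norm_sub_le_norm_sub_add_norm_sub (y s) a _).trans (by
      rw [norm_sub_rev a]; linarith [hya s, hBa B hB]))
    (fun π hπ t => hR π hπ _)
    (fun t π hπ π' hπ' hs => h.multiplier_eq hπ hπ' _ fun s hst =>
      hs s (Fin.castSucc_lt_castSucc_iff.1 hst))
  have hsqrt : Real.sqrt ((m : ℝ) * T)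
      ≤ Real.sqrt m * ∑ B ∈ P.parts, Real.sqrt (B.card : ℝ) := by
    rw [Real.sqrt_mul hm0.le]
    refine mul_le_mul_of_nonneg_left ?_ hsm.le
    have := sqrt_sum_le_sum_sqrt P.parts (fun B => (B.card : ℝ)) fun _ _ => Nat.cast_nonneg _
    rwa [← Nat.cast_sum, P.sum_card_parts, Finset.card_univ, Fintype.card_fin] at this
  have hrun : ∀ π ∈ groupedPerms P,
      (∑ s, (z s).1 - 2 * dy ^ 2 * unevenness m P
        - (R ^ 2 + dy ^ 2) * (Real.sqrt m * ∑ B ∈ P.parts, Real.sqrt (B.card : ℝ)))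
      - ∑ B ∈ P.parts, ∑ t ∈ B, inner ℝ (p π t.castSucc) (y (π t) - average B y)
      ≤ I.reward π (ω π) := fun π hπ => by
    have h3 := (h.run π hπ).reward_ge hm hT hdy.le h2 (hR π hπ) hz hw
    have h4 := sum_inner_sub_average_ge P hL (f := fun t => p π t.castSucc)
      (D := 2 * (Real.sqrt m * dy))
      (norm_sub_le_mul_stepDist ((h.run π hπ).norm_step_le hm hdy.le h2)) hwsum
      (fun B hB => (norm_sub_le_norm_sub_add_norm_sub w a _).trans (by
        rw [norm_sub_rev a]; linarith [hBa B hB]))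
    rw [mul_sum_wasserstein] at h4
    have h6 : ∑ t, inner ℝ (p π t.castSucc) (w - (z (π t)).2.2)
        = ∑ B ∈ P.parts, ∑ t ∈ B, inner ℝ (p π t.castSucc) (w - average B y)
          - ∑ B ∈ P.parts, ∑ t ∈ B, inner ℝ (p π t.castSucc) (y (π t) - average B y) := by
      rw [← sum_parts_sum P, ← Finset.sum_sub_distrib]
      refine Finset.sum_congr rfl fun B _ => ?_
      rw [← Finset.sum_sub_distrib]
      refine Finset.sum_congr rfl fun t _ => ?_
      rw [← inner_sub_right, sub_sub_sub_cancel_right]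
    have h7 := mul_le_mul_of_nonneg_left hsqrt (show 0 ≤ R ^ 2 + dy ^ 2 by positivity)
    linarith
  have hsum := Finset.sum_le_sum hrun
  rw [Finset.sum_sub_distrib, Finset.sum_const, nsmul_eq_mul] at hsum
  refine le_groupedExpectation (le_trans (le_of_eq ?_) ((sub_le_sub_left hcenter _).trans hsum))
  ring

theorem AssumptionA2.mono {I : ODMP m T} {dy dy' dr du : ℝ} (h : I.AssumptionA2 dy dr du)
    (hle : dy ≤ dy') : I.AssumptionA2 dy' dr du :=
  ⟨fun s z hz a ha i => (h.impact_bound s z hz a ha i).trans hle, h.strongly_feasible⟩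

end Main

end ODMP

theorem mainTheorem5 (dy dr du : ℝ) (hdy : 0 ≤ dy) (hdr : 0 ≤ dr) (hdu : 0 < du) :
    ∃ c : ℝ, 0 < c ∧
      ∀ (m T : ℕ), 1 ≤ m → m ≤ T →
      ∀ (I : ODMP m T), I.AssumptionA1 → I.AssumptionA2 dy dr du →
      ∀ (P : Finpartition (Finset.univ : Finset (Fin T)))
        (ω : (π : Equiv.Perm (Fin T)) → (t : Fin T) → Decision m (I.dim (π t)))
        (v : Equiv.Perm (Fin T) → Fin T → EuclideanSpace ℝ (Fin m))
        (p : Equiv.Perm (Fin T) → Fin (T + 1) → EuclideanSpace ℝ (Fin m)),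
        I.IsOnlineExecution P ω v p →
        I.zR - c * (ODMP.unevenness m P +
            Real.sqrt ((m : ℝ) * Real.log (max (m : ℝ) 2)) *
              ∑ B ∈ P.parts, Real.sqrt (B.card : ℝ))
          ≤ ODMP.groupedExpectation P (fun π => I.reward π (ω π)) := by
  -- Enlarging `dy` to `dy + 1` makes the Lipschitz constant positive, as the transport bound
  -- divides by it.
  set R : ℝ := (2 * dr + (dy + 1) ^ 2) / (2 * du) + (dy + 1) with hRdef
  have hlog : 0 < Real.sqrt (Real.log 2) := Real.sqrt_pos.2 (Real.log_pos one_lt_two)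
  have hR0 : 0 ≤ R := by positivity
  set A : ℝ := R ^ 2 + (dy + 1) ^ 2 + 4 * R * (dy + 1) with hA
  have hA0 : 0 ≤ A := by positivity
  -- Dividing by `√(log 2)` pays for the logarithm in the claim, since `max m 2 ≥ 2`.
  refine ⟨A / Real.sqrt (Real.log 2) + 2 * (dy + 1) ^ 2, by positivity, ?_⟩
  intro m T hm hT I h1 h2 P ω v p h
  set S := ∑ B ∈ P.parts, Real.sqrt (B.card : ℝ) with hSdef
  have hS : 0 ≤ S := Finset.sum_nonneg fun _ _ => Real.sqrt_nonneg _
  have hW : 0 ≤ ODMP.unevenness m P := ODMP.unevenness_nonneg P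
  set K := Real.sqrt ((m : ℝ) * Real.log (max (m : ℝ) 2)) with hK
  have hmK : Real.sqrt m * Real.sqrt (Real.log 2) ≤ K := by
    rw [hK, ← Real.sqrt_mul (Nat.cast_nonneg m)]
    gcongr
    exact le_max_right _ _
  clear_value K S A R
  have hbound : A * (Real.sqrt m * S) ≤ A / Real.sqrt (Real.log 2) * (K * S) := by
    rw [div_mul_eq_mul_div, le_div_iff₀ hlog]
    calc A * (Real.sqrt m * S) * Real.sqrt (Real.log 2)
        = A * ((Real.sqrt m * Real.sqrt (Real.log 2)) * S) := by ring
      _ ≤ A * (K * S) := by gcongr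
  have hWA : 0 ≤ A / Real.sqrt (Real.log 2) * ODMP.unevenness m P :=
    mul_nonneg (div_nonneg hA0 hlog.le) hW
  have hKS : 0 ≤ 2 * (dy + 1) ^ 2 * (K * S) :=
    mul_nonneg (by positivity) (mul_nonneg (hK ▸ Real.sqrt_nonneg _) hS)
  rw [sub_le_iff_le_add]
  -- The bound holds for every feasible `z`, so no maximizer is needed.
  refine csSup_le ?_ ?_
  · obtain ⟨z, hz, hfeas⟩ := h1.feasible
    exact ⟨_, z, fun s => subset_convexHull ℝ _ (hz s), hfeas, rfl⟩
  · rintro _ ⟨z, hz, hfeas, rfl⟩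
    have := ODMP.reward_bound_of_feasible (dy := dy + 1) (by linarith) hdr hdu hm hT
      (h2.mono (le_add_of_nonneg_right zero_le_one)) h hRdef hz hfeas
    rw [← hA, ← hSdef] at this
    linarith
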